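/- For a graph $G=(V,E)$, a function $f:V\to\mathbb{R}$ is $1$-Lipschitz if $|f(x)-f(y)|\le \mathrm{dist}_G(x,y)$ for all $x,y\in V$. Let $\mathcal{H}^d$ be the hypercube graph on $\{0,1\}^d$, in which two points are adjacent if they differ in exactly one coordinate, and let $r>0$. A local $(1,\frac14)$-Lipschitz filter over $\mathcal{H}^d$ for functions with range in $[0,r]$ is a randomized algorithm $\mathcal{A}(x,\rho)$ that gets a query $x\in\{0,1\}^d$, a random seed $\rho\in\{0,1\}^*$ drawn from a distribution that does not depend on the input function or on $x$, and (adaptive) lookup access to an input function $f:\{0,1\}^d\to[0,r]$, such that for every such $f$ the following holds with probability at least $\frac34$ over $\rho$: the function $g_\rho=\mathcal{A}(\cdot,\rho):\{0,1\}^d\to\mathbb{R}$ is $1$-Lipschitz, and $g_\rho=f$ if $f$ is $1$-Lipschitz. (The filter need not be distance-respecting: nothing else is required of $g_\rho$.) The lookup complexity of $\mathcal{A}$ on $f$ is the supremum of the number of lookups to $f$ made by $\mathcal{A}(x,\rho)$ over all queries $x$ and all seeds $\rho$ of positive probability. There is an absolute constant $\alpha>0$ such that for all even integers $r\ge 4$,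 all integers $d\ge 2^{16}r$, and every local $(1,\frac14)$-Lipschitz filter $\mathcal{A}$ over $\mathcal{H}^d$ for functions with range in $[0,r]$, there exists a function $f:\{0,1\}^d\to[0,r]$ on which the lookup complexity of $\mathcal{A}$ is at least $\left(\frac{d}{r}\right)^{\alpha r}$. -/

import Mathlib

/-- The `d`-dimensional hypercube graph on `{0,1}^d`: two points are adjacent if and only if they
differ in exactly one coordinate. -/
def hypercubeGraph (d : ℕ) : SimpleGraph (Fin d → Bool) where
  Adj x y := hammingDist x y = 1
  symm := ⟨fun x y h => by rw [hammingDist_comm]; exact h⟩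
  loopless := ⟨fun x h => by simp at h⟩

/-- `f` is `c`-Lipschitz with respect to the shortest-path distance of `G`. (`G.dist` takes the
value `0` on pairs in different components, where the distance is infinite and the condition is
void, so the condition is imposed on reachable pairs only.) -/
def IsGraphLipschitz {V : Type*} (G : SimpleGraph V) (c : ℝ) (f : V → ℝ) : Prop :=
  ∀ x y : V, G.Reachable x y → |f x - f y| ≤ c * (G.dist x y : ℝ)

/-- A deterministic adaptive computation with lookup access to a function `V → ℝ`: it either stops
and outputs a real number, or looks up the value at a point and continues depending on the answer.
No bound is put on the computation between lookups. -/
inductive LookupProgram (V : Type*) where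
  | output (value : ℝ) : LookupProgram V
  | lookup (point : V) (next : ℝ → LookupProgram V) : LookupProgram V

namespace LookupProgram

/-- The output of the program when lookups are answered by `f`. -/
noncomputable def eval {V : Type*} (f : V → ℝ) : LookupProgram V → ℝ
  | output v => v
  | lookup x next => eval f (next (f x))

/-- The number of lookups that the program makes when they are answered by `f`. -/
noncomputable def numLookups {V : Type*} (f : V → ℝ) : LookupProgram V → ℕ
  | output _ => 0
  | lookup x next => numLookups f (next (f x)) + 1

end LookupProgram

/-- A randomized local algorithm `𝒜(x, ρ)`: a distribution of the random seed `ρ ∈ {0,1}^*` and,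
for every query `x` and seed `ρ`, an adaptive program with lookup access to the input function.
The graph is hardcoded, so access to it is free. -/
structure LocalAlgorithm (V : Type*) where
  seed : PMF (List Bool)
  run : V → List Bool → LookupProgram V

namespace LocalAlgorithm

/-- The function `g_ρ` to which the algorithm with seed `ρ` provides query access on input `f`. -/
noncomputable def answer {V : Type*} (A : LocalAlgorithm V) (f : V → ℝ) (ρ : List Bool) : V → ℝ :=
  fun x => (A.run x ρ).eval f

/-- The lookup complexity of the algorithm on input `f`: the supremum of the number of lookups over all
queries and all seeds that occur with positive probability. -/
noncomputable def lookupComplexity {V : Type*} (A : LocalAlgorithm V) (f : V → ℝ) : ℕ∞ :=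
  ⨆ (x : V) (ρ ∈ A.seed.support), ((A.run x ρ).numLookups f : ℕ∞)

/-- `A` is a local `(c, δ)`-Lipschitz filter over `G` for input functions with values in `R`: for
every such `f`, with probability at least `1 - δ` over the seed, the function `g_ρ` is
`c`-Lipschitz, and it equals `f` if `f` is `c`-Lipschitz. There is no requirement on the values or
on the distance of `g_ρ` to `f` otherwise. -/
def IsLipschitzFilter {V : Type*} (A : LocalAlgorithm V) (G : SimpleGraph V) (c δ : ℝ)
    (R : Set ℝ) : Prop :=
  ∀ f : V → ℝ, (∀ x, f x ∈ R) →
    ENNReal.ofReal (1 - δ) ≤ A.seed.toOuterMeasure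
      {ρ | IsGraphLipschitz G c (A.answer f ρ) ∧ (IsGraphLipschitz G c f → A.answer f ρ = f)}

end LocalAlgorithm

/-! Write `r = 2k` and take `x`, `y` at distance `2k - 1`. A well of depth `k` at `x` and a peak of
height `k` at `y` are each Lipschitz, but together they have values `0` and `2k` at these points. A
filter must reproduce each one alone yet repair the combination. So unless a lookup from `x` (with
only the well) lands within distance less than `k` of `y`, or symmetrically, it still answers `0`
and `2k` on the combination, which is impossible (`exists_lookup_of_answer_eq`).

For each pair this happens with probability at least `1/4`, so some seed serves a quarter of all
pairs. But one lookup serves few pairs (`card_hammingSphere_filter_close_le`), and comparing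
binomials forces many lookups. Only Lipschitz inputs enter the lookup bound. -/

/-! ### Lookup programs -/

namespace LookupProgram

/-- The points that the program looks up when lookups are answered by `f`. -/
noncomputable def lookups {V : Type*} (f : V → ℝ) : LookupProgram V → List V
  | output _ => []
  | lookup x next => x :: lookups f (next (f x))

theorem length_lookups {V : Type*} (f : V → ℝ) (P : LookupProgram V) :
    (P.lookups f).length = P.numLookups f := by
  induction P with
  | output v => rfl
  | lookup x next ih => simp [lookups, numLookups, ih]

/-- Equal answers lead to equal next lookups, so despite adaptivity agreement along the run on `f`
suffices. -/
theorem eval_congr {V : Type*} {f g : V → ℝ} (P : LookupProgram V)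
    (h : ∀ z ∈ P.lookups f, f z = g z) : P.eval f = P.eval g := by
  induction P with
  | output v => rfl
  | lookup x next ih =>
    have hx : f x = g x := h x (by simp [lookups])
    simp only [eval]
    rw [← hx]
    exact ih _ fun z hz => h z (by simp [lookups, hz])

end LookupProgram

/-! ### Graph distance in the hypercube -/

theorem hammingDist_le_length {d : ℕ} {x y : Fin d → Bool} (w : (hypercubeGraph d).Walk x y) :
    hammingDist x y ≤ w.length := by
  induction w with
  | nil => simp
  | cons h p ih =>
    rename_i u v w
    have h1 : hammingDist u v = 1 := h
    have := hammingDist_triangle u v w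
    simp only [SimpleGraph.Walk.length_cons]
    omega

theorem exists_walk_length_eq_hammingDist {d : ℕ} (x y : Fin d → Bool) :
    ∃ w : (hypercubeGraph d).Walk x y, w.length = hammingDist x y := by
  induction hn : hammingDist x y generalizing x with
  | zero =>
    obtain rfl := hammingDist_eq_zero.1 hn
    exact ⟨.nil, rfl⟩
  | succ n ih =>
    have hne : x ≠ y := by
      rintro rfl
      simp at hn
    obtain ⟨i, hi⟩ := Function.ne_iff.1 hne
    have hadj : hammingDist x (Function.update x i (y i)) = 1 := by
      rw [hammingDist, Finset.card_eq_one]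
      refine ⟨i, ?_⟩
      ext j
      by_cases hj : j = i
      · subst hj; simpa using hi
      · simp [hj]
    have hrest : hammingDist (Function.update x i (y i)) y = n := by
      have h1 : Finset.univ.filter (fun j => Function.update x i (y i) j ≠ y j) =
          (Finset.univ.filter (fun j => x j ≠ y j)).erase i := by
        ext j
        by_cases hj : j = i
        · subst hj; simp
        · simp [hj]
      rw [hammingDist, h1, Finset.card_erase_of_mem (by simpa using hi)]
      rw [hammingDist] at hn
      omega
    obtain ⟨w, hw⟩ := ih _ hrest
    exact ⟨.cons (show (hypercubeGraph d).Adj _ _ from hadj) w,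
      (SimpleGraph.Walk.length_cons _ _).trans (by rw [hw])⟩

theorem hypercubeGraph_dist {d : ℕ} (x y : Fin d → Bool) :
    (hypercubeGraph d).dist x y = hammingDist x y := by
  obtain ⟨w, hw⟩ := exists_walk_length_eq_hammingDist x y
  refine le_antisymm (hw ▸ SimpleGraph.dist_le w) ?_
  obtain ⟨w', hw'⟩ := w.reachable.exists_walk_length_eq_dist
  exact hw' ▸ hammingDist_le_length w'

theorem isGraphLipschitz_hypercubeGraph_iff {d : ℕ} {f : (Fin d → Bool) → ℝ} :
    IsGraphLipschitz (hypercubeGraph d) 1 f ↔ ∀ x y, |f x - f y| ≤ hammingDist x y := by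
  refine forall₂_congr fun x y => ?_
  obtain ⟨w, -⟩ := exists_walk_length_eq_hammingDist x y
  simp [w.reachable, hypercubeGraph_dist]

/-! ### Wells and peaks -/

/-- The distance to `x`, truncated at `k`. -/
noncomputable def well {d : ℕ} (k : ℕ) (x z : Fin d → Bool) : ℝ :=
  (min k (hammingDist x z) : ℕ)

section well

variable {d k : ℕ} {x y z : Fin d → Bool}

theorem well_nonneg : 0 ≤ well k x z := Nat.cast_nonneg _

theorem well_le : well k x z ≤ k := Nat.cast_le.2 (min_le_left _ _)

theorem well_self : well k x x = 0 := by simp [well]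

theorem well_of_le (h : k ≤ hammingDist x z) : well k x z = k := by simp [well, h]

theorem abs_well_sub_well_le : |well k x y - well k x z| ≤ hammingDist y z := by
  have h1 := hammingDist_triangle x y z
  have h2 := hammingDist_triangle x z y
  rw [hammingDist_comm z y] at h2
  have h3 : min k (hammingDist x y) ≤ min k (hammingDist x z) + hammingDist y z := by omega
  have h4 : min k (hammingDist x z) ≤ min k (hammingDist x y) + hammingDist y z := by omega
  rw [← Nat.cast_le (α := ℝ), Nat.cast_add] at h3 h4
  rw [well, well, abs_sub_le_iff]
  constructor <;> linarith

end well

/-- For `x` and `y` at distance less than `2 * k`, a function with values in `[0, 2 * k]` which is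
not `1`-Lipschitz, although it is `1`-Lipschitz away from either of the two points. -/
noncomputable def wellAndPeak {d : ℕ} (k : ℕ) (x y z : Fin d → Bool) : ℝ :=
  well k x z + (k - well k y z)

/-- A Lipschitz filter whose answers at `x` and `y` are correct for the functions with only the
well at `x` and only the peak at `y` sees the difference to the function with both. -/
theorem exists_lookup_of_answer_eq {d k : ℕ} {x y : Fin d → Bool}
    (hxy : hammingDist x y < 2 * k) (P Q : LookupProgram (Fin d → Bool))
    (hP : P.eval (well k x) = 0)
    (hQ : Q.eval (fun z => 2 * k - well k y z) = 2 * k)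
    (hPQ : |P.eval (wellAndPeak k x y) - Q.eval (wellAndPeak k x y)| ≤ hammingDist x y) :
    (∃ z ∈ P.lookups (well k x), hammingDist y z < k) ∨
      ∃ z ∈ Q.lookups (fun z => 2 * k - well k y z), hammingDist x z < k := by
  by_contra! h
  rw [← P.eval_congr fun z hz => ?_, hP, ← Q.eval_congr fun z hz => ?_, hQ, zero_sub, abs_neg,
    abs_of_nonneg (by positivity)] at hPQ
  · rw [← Nat.cast_lt (α := ℝ)] at hxy
    push_cast at hxy
    linarith
  · rw [wellAndPeak, well_of_le (h.2 z hz)]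
    ring
  · rw [wellAndPeak, well_of_le (h.1 z hz)]
    ring

/-! ### Counting pairs served by lookups -/

theorem card_hammingSphere {d : ℕ} (x : Fin d → Bool) (m : ℕ) :
    (Finset.univ.filter fun y => hammingDist x y = m).card = d.choose m := by
  have hcard : (Finset.powersetCard m (Finset.univ : Finset (Fin d))).card = d.choose m := by
    rw [Finset.card_powersetCard, Finset.card_fin]
  rw [← hcard]
  refine Finset.card_nbij' (fun y => Finset.univ.filter fun i => x i ≠ y i)
    (fun T i => if i ∈ T then !x i else x i) ?_ ?_ ?_ ?_
  · intro y hy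
    simpa [Finset.mem_powersetCard, hammingDist] using hy
  · intro T hT
    have hT' : T.card = m := by simpa [Finset.mem_powersetCard] using hT
    have h : (Finset.univ.filter fun i => x i ≠ if i ∈ T then !x i else x i) = T := by
      ext i
      by_cases hi : i ∈ T <;> simp [hi]
    simp only [Finset.coe_filter, Finset.mem_univ, true_and, Set.mem_ofPred_eq, hammingDist]
    rw [h, hT']
  · intro y _
    ext i
    by_cases hi : x i = y i
    · simp [hi]
    · cases hx : x i <;> cases hy : y i <;> simp_all
  · intro T _
    ext i
    by_cases hi : i ∈ T <;> simp [hi]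

/-- The `2k - 1` coordinates where `y` differs from `x` include fewer than `k` outside the set `S`
where `z` differs from `x`, hence at least `k` inside it. Choose `k` of them in `S`, then the other
`k - 1` freely. -/
theorem card_hammingSphere_filter_close_le {d k : ℕ} (hk : 1 ≤ k) (x z : Fin d → Bool) :
    (Finset.univ.filter fun y => hammingDist x y = 2 * k - 1 ∧ hammingDist y z < k).card ≤
      2 ^ (3 * k) * (d - k).choose (k - 1) := by
  classical
  set F := Finset.univ.filter fun y => hammingDist x y = 2 * k - 1 ∧ hammingDist y z < k
  -- A single witness `y₀` bounds the distance from `x` to `z`, hence `S`.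
  obtain hF | ⟨y₀, hy₀⟩ := F.eq_empty_or_nonempty
  · simp [hF]
  set S := Finset.univ.filter fun i => x i ≠ z i with hS
  have hScard : S.card ≤ 3 * k := by
    have h1 := hammingDist_triangle x y₀ z
    have h2 : hammingDist x y₀ = 2 * k - 1 ∧ hammingDist y₀ z < k := by simpa [F] using hy₀
    change hammingDist x z ≤ 3 * k
    omega
  let D : (Fin d → Bool) → Finset (Fin d) := fun y => Finset.univ.filter fun i => x i ≠ y i
  have hD : Function.Injective D := by
    intro y y' h
    ext i
    have := Finset.ext_iff.1 h i
    simp only [D, Finset.mem_filter, Finset.mem_univ, true_and] at this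
    cases hx : x i <;> cases hy : y i <;> cases hy' : y' i <;> simp_all
  have hsub : F.image D ⊆ (Finset.powersetCard k S).biUnion fun U =>
      (Finset.powersetCard (2 * k - 1) Finset.univ).filter (U ⊆ ·) := by
    intro T hT
    obtain ⟨y, hy, rfl⟩ := Finset.mem_image.1 hT
    obtain ⟨hxy, hyz⟩ : hammingDist x y = 2 * k - 1 ∧ hammingDist y z < k := by
      simpa [F] using hy
    have h1 : (D y \ S).card ≤ hammingDist y z := by
      refine Finset.card_le_card fun i hi => ?_
      simp only [D, hS, Finset.mem_sdiff, Finset.mem_filter, Finset.mem_univ, true_and,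
        not_not] at hi ⊢
      rw [← hi.2]
      exact hi.1.symm
    have h2 : (D y).card = 2 * k - 1 := hxy
    have h3 := Finset.card_sdiff_add_card_inter (D y) S
    obtain ⟨U, hU, hUk⟩ := Finset.exists_subset_card_eq (show k ≤ (D y ∩ S).card by omega)
    simp only [Finset.mem_biUnion, Finset.mem_filter, Finset.mem_powersetCard]
    exact ⟨U, ⟨hU.trans Finset.inter_subset_right, hUk⟩, ⟨Finset.subset_univ _, h2⟩,
      hU.trans Finset.inter_subset_left⟩
  calc F.card = (F.image D).card := (Finset.card_image_of_injective _ hD).symm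
    _ ≤ _ := Finset.card_le_card hsub
    _ ≤ (Finset.powersetCard k S).card * (d - k).choose (k - 1) := by
      refine Finset.card_biUnion_le_card_mul _ _ _ fun U hU => ?_
      obtain ⟨-, hUk⟩ := Finset.mem_powersetCard.1 hU
      rw [Finset.card_filter_powersetCard_subset _ _ _ (Finset.subset_univ _) (by omega),
        Finset.card_fin, hUk]
      exact le_of_eq (congrArg _ (by omega))
    _ ≤ _ := by
      rw [Finset.card_powersetCard]
      exact Nat.mul_le_mul_right _ ((Nat.choose_le_two_pow _ _).trans
        (Nat.pow_le_pow_right (by norm_num) hScard))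

open scoped Classical in
/-- The pairs of points at distance `2 * k - 1` such that one of the points that `L` attaches to the
first is at distance less than `k` from the second. -/
noncomputable def closePairs {d : ℕ} (k : ℕ) (L : (Fin d → Bool) → List (Fin d → Bool)) :
    Finset ((Fin d → Bool) × (Fin d → Bool)) :=
  Finset.univ.filter fun p =>
    hammingDist p.1 p.2 = 2 * k - 1 ∧ ∃ z ∈ L p.1, hammingDist p.2 z < k

theorem mem_closePairs {d k : ℕ} {L : (Fin d → Bool) → List (Fin d → Bool)}
    {x y : Fin d → Bool} : (x, y) ∈ closePairs k L ↔
      hammingDist x y = 2 * k - 1 ∧ ∃ z ∈ L x, hammingDist y z < k := by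
  simp [closePairs]

theorem card_closePairs_le {d k q : ℕ} (hk : 1 ≤ k)
    (L : (Fin d → Bool) → List (Fin d → Bool)) (hL : ∀ x, (L x).length ≤ q) :
    (closePairs k L).card ≤ 2 ^ d * (q * (2 ^ (3 * k) * (d - k).choose (k - 1))) := by
  classical
  have hsub : closePairs k L ⊆
      Finset.univ.biUnion fun x => (L x).toFinset.biUnion fun z =>
        (Finset.univ.filter fun y => hammingDist x y = 2 * k - 1 ∧ hammingDist y z < k).image
          (Prod.mk x) := by
    rintro ⟨x, y⟩ h
    obtain ⟨h1, z, hz, h2⟩ := mem_closePairs.1 h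
    simp only [Finset.mem_biUnion, Finset.mem_univ, true_and, List.mem_toFinset,
      Finset.mem_image, Finset.mem_filter]
    exact ⟨x, z, hz, y, ⟨h1, h2⟩, rfl⟩
  refine (Finset.card_le_card hsub).trans ?_
  have hV : (Finset.univ : Finset (Fin d → Bool)).card = 2 ^ d := by simp
  rw [← hV]
  refine Finset.card_biUnion_le_card_mul _ _ _ fun x _ => ?_
  refine (Finset.card_biUnion_le_card_mul _ _ _ fun z _ =>
    Finset.card_image_le.trans (card_hammingSphere_filter_close_le hk x z)).trans ?_
  exact Nat.mul_le_mul_right _ ((List.toFinset_card_le _).trans (hL x))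

theorem card_pairs_hammingDist_eq (d m : ℕ) :
    (Finset.univ.filter fun p : (Fin d → Bool) × (Fin d → Bool) =>
      hammingDist p.1 p.2 = m).card = 2 ^ d * d.choose m := by
  rw [Finset.card_filter, Fintype.sum_prod_type]
  simp_rw [← Finset.card_filter, card_hammingSphere]
  simp

/-! ### Averaging over seeds -/

/-- Double counting: both sides bound the expected number of events that occur. -/
theorem PMF.card_mul_le_of_card_filter_le {α ι : Type*} (p : PMF α) (s : Finset ι)
    (E : ι → Set α) [∀ a, DecidablePred fun i => a ∈ E i] {c : ENNReal} {M : ℕ}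
    (hc : ∀ i ∈ s, c ≤ p.toOuterMeasure (E i))
    (hM : ∀ a ∈ p.support, (s.filter fun i => a ∈ E i).card ≤ M) :
    s.card * c ≤ M := by
  classical
  calc (s.card : ENNReal) * c = ∑ i ∈ s, c := by simp
    _ ≤ ∑ i ∈ s, ∑' a, (E i).indicator p a :=
      Finset.sum_le_sum fun i hi => (hc i hi).trans_eq (p.toOuterMeasure_apply _)
    _ = ∑' a, ∑ i ∈ s, (E i).indicator p a :=
      (Summable.tsum_finsetSum fun _ _ => ENNReal.summable).symm
    _ ≤ ∑' a, M * p a := by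
      refine ENNReal.tsum_le_tsum fun a => ?_
      simp only [Set.indicator_apply]
      rw [← Finset.sum_filter, Finset.sum_const, nsmul_eq_mul]
      by_cases ha : a ∈ p.support
      · gcongr
        exact hM a ha
      · simp [(p.apply_eq_zero_iff a).2 ha]
    _ = M := by rw [ENNReal.tsum_mul_left, p.tsum_coe, mul_one]

theorem PMF.quarter_le_toOuterMeasure_inter {α : Type*} (p : PMF α) {s t u : Set α}
    (hs : ENNReal.ofReal (1 - 1 / 4) ≤ p.toOuterMeasure s)
    (ht : ENNReal.ofReal (1 - 1 / 4) ≤ p.toOuterMeasure t)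
    (hu : ENNReal.ofReal (1 - 1 / 4) ≤ p.toOuterMeasure u) :
    ENNReal.ofReal (1 / 4) ≤ p.toOuterMeasure (s ∩ t ∩ u) := by
  let _ : MeasurableSpace α := ⊤
  have key : ∀ v : Set α, p.toOuterMeasure v = p.toMeasure v := fun v =>
    (p.toMeasure_apply_eq_toOuterMeasure_apply MeasurableSpace.measurableSet_top).symm
  have inter : ∀ (v w : Set α) (a : ℝ), 1 / 4 ≤ a →
      ENNReal.ofReal a ≤ p.toMeasure v → ENNReal.ofReal (1 - 1 / 4) ≤ p.toMeasure w →
      ENNReal.ofReal (a - 1 / 4) ≤ p.toMeasure (v ∩ w) := by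
    intro v w a ha hv hw
    have h1 := MeasureTheory.measureReal_union_add_inter (μ := p.toMeasure) (s := v) (t := w)
      MeasurableSpace.measurableSet_top
    have h2 := MeasureTheory.measureReal_le_one (μ := p.toMeasure) (s := v ∪ w)
    rw [ENNReal.ofReal_le_iff_le_toReal (MeasureTheory.measure_ne_top _ _)] at hv hw ⊢
    rw [MeasureTheory.Measure.real] at h1 h2
    simp only [MeasureTheory.Measure.real] at h1
    linarith
  rw [key] at hs ht hu ⊢
  have h1 := inter s t _ (by norm_num) hs ht
  have h2 := inter _ u _ (by norm_num) h1 hu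
  norm_num at h2 ⊢
  exact h2

/-! ### Binomial estimates -/

/-- Multiplying by `(2k-1).choose k ≤ 2^(2k)` turns the left side into `d.choose k * (d-k).choose
(k-1)`, and the last factor cancels. -/
theorem choose_le_of_pairs_bound {d k q : ℕ} (hk : 1 ≤ k) (hd : 2 * k ≤ d)
    (h : d.choose (2 * k - 1) ≤ 8 * (q * (2 ^ (3 * k) * (d - k).choose (k - 1)))) :
    d.choose k ≤ 8 * q * 32 ^ k := by
  have h1 := Nat.choose_mul (n := d) (k := 2 * k - 1) (s := k) (by omega)
  rw [show 2 * k - 1 - k = k - 1 by omega] at h1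
  have h2 : 0 < (d - k).choose (k - 1) := Nat.choose_pos (by omega)
  have h3 : (2 * k - 1).choose k ≤ 2 ^ (2 * k) :=
    (Nat.choose_le_two_pow _ _).trans (Nat.pow_le_pow_right (by norm_num) (by omega))
  refine Nat.le_of_mul_le_mul_right ?_ h2
  rw [← h1]
  refine (Nat.mul_le_mul h h3).trans_eq ?_
  rw [show (32 : ℕ) = 2 ^ 5 by norm_num, ← pow_mul, show 5 * k = 3 * k + 2 * k by ring, pow_add]
  ring

theorem lt_choose_of_rpow_bound {d k q : ℕ} (hk : 2 ≤ k) (hd : 2 ^ 16 * (2 * k) ≤ d)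
    (hq : (q : ℝ) ≤ ((d : ℝ) / (2 * k : ℕ)) ^ ((1 / 8 : ℝ) * (2 * k : ℕ))) :
    8 * q * 32 ^ k < d.choose k := by
  have hk0 : (0 : ℝ) < k := by positivity
  set t : ℝ := (d : ℝ) / (2 * k : ℕ) with ht
  have ht16 : (2 : ℝ) ^ 16 ≤ t := by
    rw [ht, le_div_iff₀ (by positivity)]
    exact_mod_cast hd
  -- With exponent `1/8`, `q` costs one factor `s` of `t = s ^ 4` per unit of `k`; the remaining `s
  -- ^ 3 ≥ 16 ^ 3` absorbs `8 * 32 ^ k`.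
  set s : ℝ := t ^ (1 / 4 : ℝ) with hs
  have hs4 : s ^ 4 = t := by
    rw [hs, ← Real.rpow_natCast, ← Real.rpow_mul (by positivity)]
    norm_num
  have hs0 : 0 ≤ s := by positivity
  have hs16 : 16 ≤ s := by
    refine le_of_pow_le_pow_left₀ (n := 4) (by norm_num) hs0 ?_
    rw [hs4]
    exact le_trans (by norm_num) ht16
  have hqs : (q : ℝ) ≤ s ^ k := by
    refine hq.trans_eq ?_
    rw [hs, ← Real.rpow_natCast, ← Real.rpow_mul (by positivity)]
    congr 1
    push_cast
    ring
  have hchoose : t ^ k ≤ d.choose k := by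
    refine le_trans ?_ (Nat.pow_le_choose k d)
    rw [le_div_iff₀ (by positivity)]
    have h1 : ((k.factorial : ℕ) : ℝ) ≤ (k : ℝ) ^ k := by exact_mod_cast Nat.factorial_le_pow k
    calc t ^ k * k.factorial ≤ t ^ k * (k : ℝ) ^ k := by gcongr
      _ = (t * k) ^ k := (mul_pow _ _ _).symm
      _ ≤ _ := by
        gcongr
        rw [ht]
        have h2 : (d : ℝ) / (2 * k : ℕ) * k = d / 2 := by
          push_cast
          field_simp
        rw [h2, div_le_iff₀ (by norm_num)]
        exact_mod_cast (show d ≤ (d + 1 - k) * 2 by omega)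
  have hfin : (8 : ℝ) * q * 32 ^ k < d.choose k := by
    have hsk : (0 : ℝ) < s ^ k := by positivity
    calc (8 : ℝ) * q * 32 ^ k ≤ 8 * s ^ k * 32 ^ k := by gcongr
      _ < s ^ k * 128 ^ k := by
        rw [show (128 : ℝ) = 4 * 32 by norm_num, mul_pow]
        have : (4 : ℝ) ^ 2 ≤ 4 ^ k := pow_le_pow_right₀ (by norm_num) hk
        have h32 : (0 : ℝ) < s ^ k * 32 ^ k := by positivity
        nlinarith
      _ ≤ s ^ k * (s ^ 3) ^ k := by
        gcongr
        calc (128 : ℝ) ≤ 16 ^ 3 := by norm_num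
          _ ≤ s ^ 3 := by gcongr
      _ = t ^ k := by rw [← mul_pow, ← hs4]; ring
      _ ≤ _ := hchoose
  exact_mod_cast hfin

/-! ### The lower bound -/

theorem mainTheorem3 :
    ∃ α : ℝ, 0 < α ∧
      ∀ (d r : ℕ), Even r → 4 ≤ r → 2 ^ 16 * r ≤ d →
        ∀ A : LocalAlgorithm (Fin d → Bool),
          A.IsLipschitzFilter (hypercubeGraph d) 1 (1 / 4) (Set.Icc 0 (r : ℝ)) →
          ∃ f : (Fin d → Bool) → ℝ, (∀ x, f x ∈ Set.Icc 0 (r : ℝ)) ∧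
            ENNReal.ofReal (((d : ℝ) / (r : ℝ)) ^ (α * (r : ℝ))) ≤
              ((A.lookupComplexity f : ℕ∞) : ENNReal) := by
  classical
  refine ⟨1 / 8, by norm_num, ?_⟩
  rintro d r ⟨k, hrk⟩ hr hd A hA
  obtain rfl : r = 2 * k := by omega
  clear hrk
  by_contra! hlt
  set Q : ℝ := ((d : ℝ) / (2 * k : ℕ)) ^ ((1 / 8 : ℝ) * (2 * k : ℕ)) with hQ
  have hQ0 : 0 ≤ Q := by positivity
  have hlen : ∀ f : (Fin d → Bool) → ℝ, (∀ x, f x ∈ Set.Icc 0 ((2 * k : ℕ) : ℝ)) →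
      ∀ x, ∀ ρ ∈ A.seed.support, ((A.run x ρ).lookups f).length ≤ ⌊Q⌋₊ := by
    intro f hf x ρ hρ
    rw [LookupProgram.length_lookups]
    have h1 : ((A.run x ρ).numLookups f : ℕ∞) ≤ A.lookupComplexity f :=
      le_iSup_of_le x (le_iSup₂_of_le ρ hρ le_rfl)
    have h2 := (ENat.toENNReal_le.2 h1).trans_lt (hlt f hf)
    rw [ENat.toENNReal_coe, ← ENNReal.ofReal_natCast,
      ENNReal.ofReal_lt_ofReal_iff_of_nonneg (Nat.cast_nonneg _)] at h2
    exact Nat.le_floor h2.le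
  have hwell : ∀ x y : Fin d → Bool, well k x y ∈ Set.Icc 0 ((2 * k : ℕ) : ℝ) := by
    intro x y
    have h1 := well_nonneg (k := k) (x := x) (z := y)
    have h2 := well_le (k := k) (x := x) (z := y)
    push_cast
    exact ⟨h1, by linarith⟩
  have hpeak : ∀ x y : Fin d → Bool, 2 * k - well k x y ∈ Set.Icc 0 ((2 * k : ℕ) : ℝ) := by
    intro x y
    obtain ⟨h1, h2⟩ := hwell x y
    push_cast at h2 ⊢
    exact ⟨by linarith, by linarith⟩
  have hboth : ∀ x y z : Fin d → Bool, wellAndPeak k x y z ∈ Set.Icc 0 ((2 * k : ℕ) : ℝ) := by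
    intro x y z
    have h1 := well_nonneg (k := k) (x := x) (z := z)
    have h2 := well_le (k := k) (x := x) (z := z)
    have h3 := well_nonneg (k := k) (x := y) (z := z)
    have h4 := well_le (k := k) (x := y) (z := z)
    rw [wellAndPeak]
    push_cast
    exact ⟨by linarith, by linarith⟩
  have hwellLip : ∀ x : Fin d → Bool, IsGraphLipschitz (hypercubeGraph d) 1 (well k x) :=
    fun x => isGraphLipschitz_hypercubeGraph_iff.2 fun y z => abs_well_sub_well_le
  have hpeakLip : ∀ x : Fin d → Bool,
      IsGraphLipschitz (hypercubeGraph d) 1 (fun z => 2 * k - well k x z) := by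
    refine fun x => isGraphLipschitz_hypercubeGraph_iff.2 fun y z => ?_
    rw [sub_sub_sub_cancel_left, hammingDist_comm]
    exact abs_well_sub_well_le
  set pairs := Finset.univ.filter fun p : (Fin d → Bool) × (Fin d → Bool) =>
    hammingDist p.1 p.2 = 2 * k - 1 with hpairs
  set B := 2 ^ d * (⌊Q⌋₊ * (2 ^ (3 * k) * (d - k).choose (k - 1))) with hB
  have hcount := A.seed.card_mul_le_of_card_filter_le pairs
    -- The filter succeeds on the well, the peak and their combination; one `B` counts lookups from
    -- the well side, the other from the peak side.
    (fun p => {ρ | _ ∧ _} ∩ {ρ | _ ∧ _} ∩ {ρ | _ ∧ _}) (M := B + B)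
    (fun p _ => A.seed.quarter_le_toOuterMeasure_inter (hA _ (hwell p.1)) (hA _ (hpeak p.2))
      (hA _ (hboth p.1 p.2))) (by
    intro ρ hρ
    refine le_trans (Finset.card_le_card (t :=
      closePairs k (fun x => (A.run x ρ).lookups (well k x)) ∪
      (closePairs k (fun y => (A.run y ρ).lookups (fun z => 2 * k - well k y z))).image
        Prod.swap) ?_) ?_
    · rintro ⟨x, y⟩ hxy
      obtain ⟨hp, ⟨h1, h2⟩, h3⟩ := Finset.mem_filter.1 hxy
      have hdist : hammingDist x y = 2 * k - 1 := (Finset.mem_filter.1 hp).2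
      have e1 : A.answer (well k x) ρ x = 0 := by rw [h1.2 (hwellLip x), well_self]
      have e2 : A.answer (fun z => 2 * k - well k y z) ρ y = 2 * k := by
        rw [h2.2 (hpeakLip y)]
        exact (congrArg _ well_self).trans (sub_zero _)
      have e3 := isGraphLipschitz_hypercubeGraph_iff.1 h3.1 x y
      rw [Finset.mem_union, Finset.mem_image]
      obtain h | h := exists_lookup_of_answer_eq (by omega) _ _ e1 e2 e3
      · exact Or.inl (mem_closePairs.2 ⟨hdist, h⟩)
      · exact Or.inr ⟨(y, x), mem_closePairs.2 ⟨(hammingDist_comm y x).trans hdist, h⟩, rfl⟩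
    · refine (Finset.card_union_le _ _).trans (Nat.add_le_add ?_ (Finset.card_image_le.trans ?_))
      · exact card_closePairs_le (by omega) _ fun x => hlen _ (hwell x) x ρ hρ
      · exact card_closePairs_le (by omega) _ fun x => hlen _ (hpeak x) x ρ hρ)
  have hcount' : 2 ^ d * d.choose (2 * k - 1) ≤ 4 * (B + B) := by
    rw [hpairs, card_pairs_hammingDist_eq, ← ENNReal.ofReal_natCast, ← ENNReal.ofReal_natCast,
      ← ENNReal.ofReal_mul (Nat.cast_nonneg _), ENNReal.ofReal_le_ofReal_iff (Nat.cast_nonneg _)]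
      at hcount
    rw [← Nat.cast_le (α := ℝ)]
    push_cast at hcount ⊢
    linarith
  refine absurd (lt_choose_of_rpow_bound (by omega) hd (Nat.floor_le hQ0)) (not_lt.2 ?_)
  refine choose_le_of_pairs_bound (by omega) (by omega) ?_
  refine Nat.le_of_mul_le_mul_left (hcount'.trans_eq ?_) (Nat.two_pow_pos d)
  rw [hB]
  ring
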